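/- Let $(\Omega,\mathcal F,(\mathcal F_t)_{t\ge 0},P)$ be a filtered probability space such that (C) every $(\mathcal F_t)$-martingale is continuous, i.e. has a version with almost surely continuous paths. Let $\Gamma\subseteq[0,\infty)\times\Omega$ be an $(\mathcal F_t)$-previsible set and let $\mathcal G(\omega)=\sup\{t\ge 0:(t,\omega)\in\Gamma\}\in[0,\infty]$ (with $\sup\emptyset=0$) be its end, a random time. Assume that (A) $P(\mathcal G=T)=0$ for every $(\mathcal F_t)$-stopping time $T$ with values in $[0,\infty]$. Then the Azéma supermartingale $Z_t^{\mathcal G}=P(\mathcal G>t\mid\mathcal F_t)$ has an adapted version with almost surely continuous paths, and for every such version $$E\Big[\sup_{t\ge 0}Z_t^{\mathcal G}\big(1-Z_t^{\mathcal G}\big)\Big]=\frac14=\sup_{T}E\Big[Z_T^{\mathcal G}\big(1-Z_T^{\mathcal G}\big)\Big],$$ where $T$ runs over all $(\mathcal F_t)$-stopping times with values in $[0,\infty]$, $Z_T^{\mathcal G}$ is read as $Z_\infty^{\mathcal G}=\lim_{t\to\infty}Z_t^{\mathcal G}$ on $\{T=\infty\}$, and all the random variables under the expectations are integrable. -/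

import Mathlib

open MeasureTheory ProbabilityTheory Filter
open scoped NNReal ENNReal

namespace AzemaNST

/-- The end `ω ↦ sup {t : (t, ω) ∈ Γ}` of a random set `Γ ⊆ [0, ∞) × Ω`, with values in `[0, ∞]`
and with the convention `sup ∅ = 0`. -/
noncomputable def endOf {Ω : Type*} (Γ : Set (ℝ≥0 × Ω)) (ω : Ω) : ℝ≥0∞ :=
  ⨆ t ∈ {t : ℝ≥0 | (t, ω) ∈ Γ}, (t : ℝ≥0∞)

/-- `Y` is a version (modification) of `X` with almost surely continuous paths. -/
def IsContinuousVersion {Ω : Type*} {m : MeasurableSpace Ω} (P : Measure Ω)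
    (X Y : ℝ≥0 → Ω → ℝ) : Prop :=
  (∀ t, Y t =ᵐ[P] X t) ∧ ∀ᵐ ω ∂P, Continuous fun t => Y t ω

/-- Assumption (C): all martingales of the filtration are continuous (up to modification). -/
def AllMartingalesContinuous {Ω : Type*} {m : MeasurableSpace Ω} (P : Measure Ω)
    (𝓕 : Filtration ℝ≥0 m) : Prop :=
  ∀ M : ℝ≥0 → Ω → ℝ, Martingale M 𝓕 P → ∃ N : ℝ≥0 → Ω → ℝ, IsContinuousVersion P M N

/-- Assumption (A): `P (G = T) = 0` for every stopping time `T` with values in `[0, ∞]`. -/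
def AvoidsStoppingTimes {Ω : Type*} {m : MeasurableSpace Ω} (P : Measure Ω)
    (𝓕 : Filtration ℝ≥0 m) (G : Ω → ℝ≥0∞) : Prop :=
  ∀ T : Ω → ℝ≥0∞, IsStoppingTime 𝓕 T → P {ω | G ω = T ω} = 0

/-- `Z` is a continuous version of the Azéma supermartingale `P (G > t | 𝓕 t)`. -/
def IsContinuousAzema {Ω : Type*} {m : MeasurableSpace Ω} (P : Measure Ω)
    (𝓕 : Filtration ℝ≥0 m) (G : Ω → ℝ≥0∞) (Z : ℝ≥0 → Ω → ℝ) : Prop :=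
  StronglyAdapted 𝓕 Z ∧
    IsContinuousVersion P (fun t => P⟦{ω | (t : ℝ≥0∞) < G ω} | 𝓕 t⟧) Z

/-- The value `Z_T` of a process at a time `T` with values in `[0, ∞]`; where `T = ∞` it is the
limit `Z_∞` of the path. -/
noncomputable def valueAt {Ω : Type*} (Z : ℝ≥0 → Ω → ℝ) (T : Ω → ℝ≥0∞) (ω : Ω) : ℝ :=
  if T ω = ∞ then limUnder atTop (fun t => Z t ω) else Z (T ω).toNNReal ω

end AzemaNST

namespace AzemaNST

open Topology

/-! ### Entry times along countable sets of times, and a maximal inequality for them. -/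

section FirstEntry

variable {Ω : Type*} {m : MeasurableSpace Ω} {P : Measure Ω}

/-! The function z(1 - z) has maximum 1/4, attained only at z = 1/2, so both identities reduce to
showing that almost every path of Z passes through 1/2. Assumption (A) with T = 0 gives Z_0 = 1;
with T = ∞ it gives G < ∞ almost surely, and a maximal inequality then gives Z_∞ = 0. The
intermediate value theorem supplies the crossing, and stopping on a fine grid near 1/2 gives
stopping times whose expectations approach 1/4.

The harder half is the existence of a continuous version. For q slightly below r, Z_q differs from
P(G > r | F_q), a continuous martingale in q by (C), by at most the conditional probability that G
falls in a short interval after q. If these probabilities were not uniformly small, the entry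
inequality `mul_measure_biUnion_le` together with the reverse Fatou lemma `le_measure_frequently`
would make G equal, with positive probability, to a limit of first entry times.

That limit is only an optional time, because the filtration is not assumed right-continuous. Under
(C), however, a positive finite optional time is announced by earlier optional times and so agrees
almost surely with a true stopping time (`exists_isStoppingTime`). Hence (A) excludes it. -/

theorem le_measure_frequently [IsFiniteMeasure P] {Q : ℕ → Set Ω}
    (hQ : ∀ n, NullMeasurableSet (Q n) P) {a : ℝ≥0∞} (h : ∀ᶠ n in atTop, a ≤ P (Q n)) :
    a ≤ P {ω | ∃ᶠ n in atTop, ω ∈ Q n} := by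
  have hset : {ω | ∃ᶠ n in atTop, ω ∈ Q n} = ⋂ n, ⋃ k ≥ n, Q k := by
    ext ω
    simp [frequently_atTop]
  rw [hset]
  have hlim := tendsto_measure_iInter_atTop (μ := P) (s := fun n => ⋃ k ≥ n, Q k)
    (fun n => NullMeasurableSet.iUnion fun k => NullMeasurableSet.iUnion fun _ => hQ k)
    (fun i j hij => Set.iUnion₂_subset fun k hk =>
      Set.subset_biUnion_of_mem (u := Q) (show i ≤ k from hij.trans hk))
    ⟨0, measure_ne_top _ _⟩
  refine ge_of_tendsto' hlim fun n => ?_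
  obtain ⟨k, hk, hn⟩ := (h.and (eventually_ge_atTop n)).exists
  exact hk.trans (measure_mono (Set.subset_biUnion_of_mem (u := Q) hn))

/-- The first time in `D` at which `ω` belongs to `E t`. -/
noncomputable def entryTime (D : Set ℝ≥0) (E : ℝ≥0 → Set Ω) (ω : Ω) : ℝ≥0∞ :=
  ⨅ t ∈ {t ∈ D | ω ∈ E t}, (t : ℝ≥0∞)

theorem entryTime_le {D : Set ℝ≥0} {E : ℝ≥0 → Set Ω} {ω : Ω} {t : ℝ≥0} (ht : t ∈ D)
    (hω : ω ∈ E t) : entryTime D E ω ≤ t :=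
  iInf₂_le (f := fun (t : ℝ≥0) _ => (t : ℝ≥0∞)) t (show t ∈ {t ∈ D | ω ∈ E t} from ⟨ht, hω⟩)

theorem entryTime_lt_iff {D : Set ℝ≥0} {E : ℝ≥0 → Set Ω} {ω : Ω} {a : ℝ≥0∞} :
    entryTime D E ω < a ↔ ∃ t ∈ D, ω ∈ E t ∧ (t : ℝ≥0∞) < a := by
  simp [entryTime, iInf_lt_iff, and_assoc]

/-- `S` is an optional time: `{S < t} ∈ 𝓕 t` for all `t`. -/
def IsOptionalTime (𝓕 : Filtration ℝ≥0 m) (S : Ω → ℝ≥0∞) : Prop :=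
  ∀ t : ℝ≥0, MeasurableSet[𝓕 t] {ω | S ω < t}

variable {𝓕 : Filtration ℝ≥0 m}

theorem isOptionalTime_entryTime {D : Set ℝ≥0} (hD : D.Countable) {E : ℝ≥0 → Set Ω}
    (hE : ∀ t ∈ D, MeasurableSet[𝓕 t] (E t)) : IsOptionalTime 𝓕 (entryTime D E) := by
  intro t
  have : {ω | entryTime D E ω < t} = ⋃ s ∈ {s ∈ D | s < t}, E s := by
    ext ω
    simp only [Set.mem_ofPred_eq, entryTime_lt_iff, ENNReal.coe_lt_coe, Set.mem_iUnion]
    exact ⟨fun ⟨s, h1, h2, h3⟩ => ⟨s, ⟨h1, h3⟩, h2⟩, fun ⟨s, ⟨h1, h3⟩, h2⟩ => ⟨s, h1, h2, h3⟩⟩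
  rw [this]
  exact MeasurableSet.biUnion (hD.mono fun s hs => hs.1)
    fun s hs => 𝓕.mono hs.2.le _ (hE s hs.1)

theorem IsOptionalTime.measurable {S : Ω → ℝ≥0∞} (hS : IsOptionalTime 𝓕 S) : Measurable S := by
  refine measurable_of_Iio fun a => ?_
  induction a with
  | coe a => exact 𝓕.le a _ (hS a)
  | top =>
    have : S ⁻¹' Set.Iio ⊤ = ⋃ n : ℕ, {ω | S ω < ((n : ℝ≥0) : ℝ≥0∞)} := by
      ext ω
      simp only [Set.mem_preimage, Set.mem_Iio, Set.mem_iUnion, Set.mem_ofPred_eq]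
      refine ⟨fun h => ?_, fun ⟨n, hn⟩ => hn.trans ENNReal.coe_lt_top⟩
      obtain ⟨n, hn⟩ := ENNReal.exists_nat_gt h.ne
      exact ⟨n, by simpa using hn⟩
    rw [this]
    exact MeasurableSet.iUnion fun n => 𝓕.le _ _ (hS _)

/-- Strict bounds on each term only bound the supremum weakly; a rational level below t restores
strictness. -/
theorem IsOptionalTime.iSup {S : ℕ → Ω → ℝ≥0∞} (hS : ∀ n, IsOptionalTime 𝓕 (S n)) :
    IsOptionalTime 𝓕 (fun ω => ⨆ n, S n ω) := by
  intro t
  have : {ω | ⨆ n, S n ω < t} = ⋃ q ∈ {q : ℚ | Real.toNNReal q < t}, ⋂ n, {ω | S n ω < Real.toNNReal q} := by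
    ext ω
    simp only [Set.mem_ofPred_eq, Set.mem_iUnion, Set.mem_iInter, exists_prop]
    constructor
    · intro h
      obtain ⟨q, -, h1, h2⟩ := ENNReal.lt_iff_exists_rat_btwn.1 h
      exact ⟨q, by exact_mod_cast h2, fun n => (le_iSup (fun n => S n ω) n).trans_lt h1⟩
    · rintro ⟨q, hq, h⟩
      exact (iSup_le fun n => (h n).le).trans_lt (by exact_mod_cast hq)
  rw [this]
  exact MeasurableSet.biUnion (Set.to_countable _)
    fun q hq => MeasurableSet.iInter fun n => 𝓕.mono (le_of_lt hq) _ (hS n _)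

theorem IsOptionalTime.measurable_min {S : Ω → ℝ≥0∞} (hS : IsOptionalTime 𝓕 S) (t : ℝ≥0) :
    Measurable[𝓕 t] fun ω => min (S ω) t := by
  refine measurable_of_Iio fun a => ?_
  by_cases ha : a ≤ t
  · lift a to ℝ≥0 using (ha.trans_lt ENNReal.coe_lt_top).ne
    have : (fun ω => min (S ω) (t : ℝ≥0∞)) ⁻¹' Set.Iio (a : ℝ≥0∞) = {ω | S ω < a} := by
      ext ω
      simp only [Set.mem_preimage, Set.mem_Iio, min_lt_iff, Set.mem_ofPred_eq, not_lt.2 ha, or_false]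
    rw [this]
    exact 𝓕.mono (by exact_mod_cast ha) _ (hS a)
  · have : (fun ω => min (S ω) (t : ℝ≥0∞)) ⁻¹' Set.Iio a = Set.univ := by
      ext ω
      simp [not_le.1 ha]
    rw [this]
    exact MeasurableSet.univ

/-- Splitting by the first t in F with ω in `E t` gives disjoint pieces, each measurable at its own
time, so `hc` applies to each and the bounds add up. -/
theorem mul_measure_biUnion_finset_le (F : Finset ℝ≥0) {E H : ℝ≥0 → Set Ω}
    (hE : ∀ t ∈ F, MeasurableSet[𝓕 t] (E t)) (hH : ∀ t ∈ F, MeasurableSet (H t)) {c : ℝ≥0∞}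
    (hc : ∀ t ∈ F, ∀ B, MeasurableSet[𝓕 t] B → B ⊆ E t → c * P B ≤ P (B ∩ H t)) :
    c * P (⋃ t ∈ F, E t) ≤ P (⋃ t ∈ F, (E t \ ⋃ s ∈ {s ∈ F | s < t}, E s) ∩ H t) := by
  set B : ℝ≥0 → Set Ω := fun t => E t \ ⋃ s ∈ {s ∈ F | s < t}, E s with hB
  have hBm : ∀ t ∈ F, MeasurableSet[𝓕 t] (B t) := fun t ht =>
    (hE t ht).diff (Finset.measurableSet_biUnion _ fun s hs =>
      𝓕.mono (Finset.mem_filter.1 hs).2.le _ (hE s (Finset.mem_filter.1 hs).1))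
  have hsub : (⋃ t ∈ F, E t) ⊆ ⋃ t ∈ F, B t := by
    intro ω hω
    simp only [Set.mem_iUnion, exists_prop] at hω
    obtain ⟨t, ht⟩ := hω
    classical
    obtain ⟨u, hu, hmin⟩ := Finset.exists_min_image {s ∈ F | ω ∈ E s} id
      ⟨t, Finset.mem_filter.2 ht⟩
    obtain ⟨huF, huE⟩ := Finset.mem_filter.1 hu
    simp only [Set.mem_iUnion, exists_prop]
    refine ⟨u, huF, huE, ?_⟩
    simp only [Set.mem_iUnion, exists_prop, not_exists, not_and]
    intro s hs hsE
    have := Finset.mem_filter.1 hs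
    exact absurd (hmin s (Finset.mem_filter.2 ⟨this.1, hsE⟩)) (not_le.2 this.2)
  have hdisj : Set.PairwiseDisjoint (F : Set ℝ≥0) fun t => B t ∩ H t := by
    have key : ∀ s ∈ F, ∀ t, s < t → Disjoint (B s ∩ H s) (B t ∩ H t) := by
      intro s hs t hst
      refine Set.disjoint_left.2 fun ω h1 h2 => h2.1.2 ?_
      simp only [Set.mem_iUnion, exists_prop]
      exact ⟨s, Finset.mem_filter.2 ⟨hs, hst⟩, h1.1.1⟩
    intro s hs t ht hst
    rcases lt_or_gt_of_ne hst with h | h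
    · exact key s hs t h
    · exact (key t ht s h).symm
  calc c * P (⋃ t ∈ F, E t) ≤ c * ∑ t ∈ F, P (B t) := by
        gcongr
        exact (measure_mono hsub).trans (measure_biUnion_finset_le _ _)
    _ = ∑ t ∈ F, c * P (B t) := Finset.mul_sum _ _ _
    _ ≤ ∑ t ∈ F, P (B t ∩ H t) :=
        Finset.sum_le_sum fun t ht => hc t ht _ (hBm t ht) Set.sdiff_subset
    _ = P (⋃ t ∈ F, B t ∩ H t) := (measure_biUnion_finset hdisj fun t ht =>
        (𝓕.le t _ (hBm t ht)).inter (hH t ht)).symm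

/-- A lower bound for the probability that `H` happens at, or at times of `D` decreasing to, the
first entry time into `E`. -/
theorem mul_measure_biUnion_le [IsFiniteMeasure P] {D : Set ℝ≥0} (hD : D.Countable)
    {E H : ℝ≥0 → Set Ω} (hE : ∀ t ∈ D, MeasurableSet[𝓕 t] (E t))
    (hH : ∀ t ∈ D, MeasurableSet (H t)) {c : ℝ≥0∞}
    (hc : ∀ t ∈ D, ∀ B, MeasurableSet[𝓕 t] B → B ⊆ E t → c * P B ≤ P (B ∩ H t)) :
    c * P (⋃ t ∈ D, E t) ≤ P {ω | (∃ t ∈ D, ω ∈ E t) ∧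
      ∀ a, entryTime D E ω < a → ∃ t ∈ D, ω ∈ E t ∧ ω ∈ H t ∧ (t : ℝ≥0∞) < a} := by
  rcases D.eq_empty_or_nonempty with rfl | hne
  · simp
  obtain ⟨d, rfl⟩ := hD.exists_eq_range hne
  classical
  set F : ℕ → Finset ℝ≥0 := fun n => (Finset.range n).image d with hF
  have hFD : ∀ n, ∀ t ∈ F n, t ∈ Set.range d := by
    intro n t ht
    obtain ⟨k, -, rfl⟩ := Finset.mem_image.1 ht
    exact ⟨k, rfl⟩
  have hFmono : Monotone F := fun i j hij =>
    Finset.image_subset_image (Finset.range_mono hij)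
  set Q : ℕ → Set Ω := fun n => ⋃ t ∈ F n, (E t \ ⋃ s ∈ {s ∈ F n | s < t}, E s) ∩ H t with hQ
  have hQm : ∀ n, MeasurableSet (Q n) := fun n => Finset.measurableSet_biUnion _ fun t ht =>
    ((𝓕.le t _ (hE t (hFD n t ht))).diff (Finset.measurableSet_biUnion _ fun s hs =>
      𝓕.le s _ (hE s (hFD n s (Finset.mem_filter.1 hs).1)))).inter (hH t (hFD n t ht))
  have hbound : ∀ n, c * P (⋃ t ∈ F n, E t) ≤ P (Q n) := fun n =>
    mul_measure_biUnion_finset_le (F n) (fun t ht => hE t (hFD n t ht))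
      (fun t ht => hH t (hFD n t ht)) fun t ht => hc t (hFD n t ht)
  have hmonoE : Monotone fun n => ⋃ t ∈ F n, E t := fun i j hij =>
    Set.biUnion_subset_biUnion_left (hFmono hij)
  have hfreq : ∀ n, c * P (⋃ t ∈ F n, E t) ≤ P {ω | ∃ᶠ n in atTop, ω ∈ Q n} := fun n =>
    le_measure_frequently (fun n => (hQm n).nullMeasurableSet)
      ((eventually_ge_atTop n).mono fun k hk => 
        (mul_le_mul_right (measure_mono (hmonoE hk)) c).trans (hbound k))
  have hU : (⋃ t ∈ Set.range d, E t) = ⋃ n, ⋃ t ∈ F n, E t := by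
    ext ω
    simp only [Set.mem_iUnion, exists_prop, Set.mem_range, exists_exists_eq_and]
    constructor
    · rintro ⟨k, hk⟩
      exact ⟨k + 1, d k, Finset.mem_image.2 ⟨k, by simp, rfl⟩, hk⟩
    · rintro ⟨n, t, ht, h⟩
      obtain ⟨k, rfl⟩ := hFD n t ht
      exact ⟨k, h⟩
  rw [hU, hmonoE.measure_iUnion, ENNReal.mul_iSup]
  refine iSup_le fun n => (hfreq n).trans (measure_mono ?_)
  intro ω hω
  obtain ⟨n₀, hn₀⟩ := hω.exists
  simp only [hQ, Set.mem_iUnion, exists_prop] at hn₀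
  obtain ⟨t₀, ht₀, h₀⟩ := hn₀
  refine ⟨⟨t₀, hFD _ _ ht₀, h₀.1.1⟩, fun a ha => ?_⟩
  obtain ⟨s, ⟨k, rfl⟩, hsE, hsa⟩ := entryTime_lt_iff.1 ha
  -- Once n exceeds k, the finite set `F n` contains `d k`, so the first entry along `F n`, where
  -- `H` occurs, is at most `d k` and hence below a.
  obtain ⟨n, hn, hk⟩ := (hω.and_eventually (eventually_gt_atTop k)).exists
  simp only [hQ, Set.mem_iUnion, exists_prop] at hn
  obtain ⟨t, ht, ⟨htE, htn⟩, htH⟩ := hn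
  refine ⟨t, hFD n t ht, htE, htH, lt_of_le_of_lt ?_ hsa⟩
  by_contra hlt
  refine htn ?_
  simp only [Set.mem_iUnion, exists_prop]
  exact ⟨d k, Finset.mem_filter.2 ⟨Finset.mem_image.2 ⟨k, Finset.mem_range.2 hk, rfl⟩,
    by exact_mod_cast not_le.1 hlt⟩, hsE⟩

end FirstEntry

/-! ### Under (C), optional times are almost surely stopping times. -/

section Announcing

variable {Ω : Type*} {m : MeasurableSpace Ω} {P : Measure Ω} {𝓕 : Filtration ℝ≥0 m}

theorem integrable_indicator_one [IsFiniteMeasure P] {A : Set Ω} (hA : MeasurableSet A) :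
    Integrable (A.indicator fun _ => (1 : ℝ)) P :=
  (integrable_const 1).indicator hA

theorem condExp_indicator_mono [IsFiniteMeasure P] {A B : Set Ω} (hA : MeasurableSet A)
    (hB : MeasurableSet B) (h : A ⊆ B) (m' : MeasurableSpace Ω) : P⟦A | m'⟧ ≤ᵐ[P] P⟦B | m'⟧ :=
  condExp_mono (integrable_indicator_one hA) (integrable_indicator_one hB) <|
    Eventually.of_forall fun ω => Set.indicator_le_indicator_of_subset h (fun _ => zero_le_one) ω

theorem condExp_indicator_self [IsFiniteMeasure P] {m' : MeasurableSpace Ω} (hm : m' ≤ m)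
    {A : Set Ω} (hA : MeasurableSet[m'] A) : P⟦A | m'⟧ = A.indicator fun _ => (1 : ℝ) :=
  condExp_of_stronglyMeasurable hm
    ((stronglyMeasurable_const (b := (1 : ℝ))).indicator hA) (integrable_indicator_one (hm _ hA))

/-- Integrating the conditional probability over B gives exactly the hypothesis `hc` of the entry
inequality. -/
theorem ofReal_mul_measure_le_of_le_condExp [IsFiniteMeasure P] {m' : MeasurableSpace Ω}
    (hm : m' ≤ m) {H B : Set Ω} (hH : MeasurableSet[m] H) (hB : MeasurableSet[m'] B) {ε : ℝ}
    (h : B ⊆ {ω | ε < (P⟦H | m'⟧) ω}) : ENNReal.ofReal ε * P B ≤ P (B ∩ H) := by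
  have h1 : ε * P.real B ≤ ∫ ω in B, (P⟦H | m'⟧) ω ∂P :=
    setIntegral_ge_of_const_le_real (hm _ hB) (measure_ne_top _ _) (fun ω hω => (h hω).le)
      integrable_condExp.integrableOn
  rw [setIntegral_condExp hm (integrable_indicator_one hH) hB,
    setIntegral_indicator hH, setIntegral_const, smul_eq_mul, mul_one] at h1
  rcases le_or_gt ε 0 with hε | hε
  · simp [ENNReal.ofReal_of_nonpos hε]
  · rw [← ofReal_measureReal (μ := P) (s := B), ← ofReal_measureReal (μ := P) (s := B ∩ H),
      ← ENNReal.ofReal_mul hε.le]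
    exact ENNReal.ofReal_le_ofReal h1

theorem AllMartingalesContinuous.exists_continuous (hC : AllMartingalesContinuous P 𝓕)
    [IsFiniteMeasure P] (X : Ω → ℝ) {D : Set ℝ≥0} (hD : D.Countable) :
    ∀ᵐ ω ∂P, ∃ f : ℝ≥0 → ℝ, Continuous f ∧ ∀ t ∈ D, (P[X | 𝓕 t]) ω = f t := by
  obtain ⟨N, hN, hcont⟩ := hC _ (martingale_condExp X 𝓕 P)
  filter_upwards [hcont, (ae_ball_iff hD).2 fun t _ => hN t] with ω h1 h2
  exact ⟨_, h1, fun t ht => (h2 t ht).symm⟩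

/-- The supremum of optional times, on the event that it is not attained, is a stopping time. -/
theorem isStoppingTime_iSup_of_lt {R : ℕ → Ω → ℝ≥0∞} (hR : ∀ n, IsOptionalTime 𝓕 (R n))
    (T : Ω → ℝ≥0∞) (hT : ∀ ω, (∀ n, R n ω < ⨆ k, R k ω) → T ω = ⨆ k, R k ω)
    (hT' : ∀ ω, ¬ (∀ n, R n ω < ⨆ k, R k ω) → T ω = ⊤) : IsStoppingTime 𝓕 T := by
  intro t
  -- If the supremum is not attained, it is at most t exactly when every `R n` is below t, so
  -- optionality suffices. Non-attainment is read off the truncations at t, which are measurable at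
  -- time t.
  have hset : {ω | T ω ≤ (t : ℝ≥0∞)} =
      (⋂ n, {ω | R n ω < t}) ∩ ⋂ n, ⋃ k, {ω | min (R n ω) t < min (R k ω) t} := by
    ext ω
    simp only [Set.mem_ofPred_eq, Set.mem_inter_iff, Set.mem_iInter, Set.mem_iUnion]
    constructor
    · intro h
      by_cases hlt : ∀ n, R n ω < ⨆ k, R k ω
      · rw [hT ω hlt] at h
        refine ⟨fun n => (hlt n).trans_le h, fun n => ?_⟩
        obtain ⟨k, hk⟩ := lt_iSup_iff.1 (hlt n)
        refine ⟨k, ?_⟩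
        rwa [min_eq_left ((hlt n).le.trans h), min_eq_left ((hlt k).le.trans h)]
      · rw [hT' ω hlt] at h
        exact absurd h (not_le.2 ENNReal.coe_lt_top)
    · rintro ⟨h1, h2⟩
      have hlt : ∀ n, R n ω < ⨆ k, R k ω := fun n => by
        obtain ⟨k, hk⟩ := h2 n
        rw [min_eq_left (h1 n).le, min_eq_left (h1 k).le] at hk
        exact hk.trans_le (le_iSup (fun k => R k ω) k)
      rw [hT ω hlt]
      exact iSup_le fun n => (h1 n).le
  change MeasurableSet[𝓕 t] {ω | T ω ≤ (t : ℝ≥0∞)}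
  rw [hset]
  exact (MeasurableSet.iInter fun n => hR n t).inter (MeasurableSet.iInter fun n =>
    MeasurableSet.iUnion fun k =>
      measurableSet_lt ((hR n).measurable_min t) ((hR k).measurable_min t))

theorem mem_limsup_ae [IsProbabilityMeasure P] {Q : ℕ → Set Ω} (hQ : ∀ n, MeasurableSet (Q n))
    {c : ℕ → ℝ≥0∞} (hc : Tendsto c atTop (𝓝 1)) (h : ∀ n, c n ≤ P (Q n)) :
    ∀ᵐ ω ∂P, ∃ᶠ n in atTop, ω ∈ Q n := by
  have hm : MeasurableSet {ω | ∃ᶠ n in atTop, ω ∈ Q n} := by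
    have hset : {ω | ∃ᶠ n in atTop, ω ∈ Q n} = ⋂ n, ⋃ k ≥ n, Q k := by
      ext ω
      simp [frequently_atTop]
    rw [hset]
    exact MeasurableSet.iInter fun n => MeasurableSet.iUnion fun k =>
      MeasurableSet.iUnion fun _ => hQ k
  change {ω | ∃ᶠ n in atTop, ω ∈ Q n} ∈ ae P
  rw [mem_ae_iff_prob_eq_one hm]
  refine le_antisymm prob_le_one (le_of_forall_lt fun a ha => ?_)
  obtain ⟨b, hab, hb⟩ := exists_between ha
  refine hab.trans_le (le_measure_frequently (fun n => (hQ n).nullMeasurableSet) ?_)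
  filter_upwards [hc.eventually (lt_mem_nhds hb)] with n hn using hn.le.trans (h n)

/-- Optional times that are positive and finite are, up to null sets, stopping times. -/
theorem AllMartingalesContinuous.exists_isStoppingTime [IsProbabilityMeasure P]
    (hC : AllMartingalesContinuous P 𝓕) {S : Ω → ℝ≥0∞} (hS : IsOptionalTime 𝓕 S) :
    ∃ T : Ω → ℝ≥0∞, IsStoppingTime 𝓕 T ∧ ∀ᵐ ω ∂P, 0 < S ω → S ω < ⊤ → S ω = T ω := by
  obtain ⟨D, hD, hdense⟩ := TopologicalSpace.exists_countable_dense ℝ≥0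
  set h : ℕ → ℝ≥0 := fun n => 1 / ((n : ℝ≥0) + 1) with hh
  have hpos : ∀ n, 0 < h n := fun n => by positivity
  have hlim : Tendsto h atTop (𝓝 0) := tendsto_one_div_add_atTop_nhds_zero_nat
  have hm : ∀ a : ℝ≥0, MeasurableSet {ω | S ω ≤ a} := fun a => hS.measurable measurableSet_Iic
  -- The time `R n` is the first at which S is predicted, with conditional probability above 1 - `h
  -- n`, to occur within the next `h n`. These times will announce S.
  set E : ℕ → ℝ≥0 → Set Ω := fun n t =>
    {ω | 1 - (h n : ℝ) < (P⟦{ω | S ω ≤ (t + h n : ℝ≥0)} | 𝓕 t⟧) ω} with hE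
  have hEm : ∀ n t, MeasurableSet[𝓕 t] (E n t) := fun n t =>
    measurableSet_lt measurable_const stronglyMeasurable_condExp.measurable
  set R : ℕ → Ω → ℝ≥0∞ := fun n => entryTime D (E n) with hR
  have hRopt : ∀ n, IsOptionalTime 𝓕 (R n) := fun n =>
    isOptionalTime_entryTime hD fun t _ => hEm n t
  classical
  refine ⟨fun ω => if ∀ n, R n ω < ⨆ k, R k ω then ⨆ k, R k ω else ⊤,
    isStoppingTime_iSup_of_lt hRopt _ (fun ω hω => if_pos hω) (fun ω hω => if_neg hω), ?_⟩
  -- The prediction is right with probability at least 1 - `h n`, and `Q n` is vacuous where `R n`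
  -- is infinite. So almost surely S ≤ `R n` + `h n` for infinitely many n.
  have hge : ∀ᵐ ω ∂P, S ω ≤ ⨆ k, R k ω := by
    set Q : ℕ → Set Ω := fun n => {ω | R n ω < ⊤ → S ω ≤ R n ω + h n} with hQ
    have hRm : ∀ n, Measurable (R n) := fun n => (hRopt n).measurable
    have hgood : ∀ n, MeasurableSet {ω | S ω ≤ R n ω + h n} := fun n =>
      measurableSet_le hS.measurable ((hRm n).add_const _)
    have hfin : ∀ n, MeasurableSet {ω | R n ω < ⊤} := fun n => hRm n measurableSet_Iio
    have hQm : ∀ n, MeasurableSet (Q n) := fun n => (hfin n).imp (hgood n)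
    have hle : ∀ n, ENNReal.ofReal (1 - h n) ≤ P (Q n) := by
      intro n
      set c := ENNReal.ofReal (1 - h n)
      have hc1 : c ≤ 1 := ENNReal.ofReal_le_one.2 (by linarith [(h n).coe_nonneg])
      have hentry : c * P {ω | R n ω < ⊤} ≤ P ({ω | R n ω < ⊤} ∩ Q n) := by
        have hU : {ω | R n ω < ⊤} = ⋃ t ∈ D, E n t := by
          ext ω
          simp only [hR, Set.mem_ofPred_eq, entryTime_lt_iff, Set.mem_iUnion, exists_prop,
            ENNReal.coe_lt_top, and_true]
        nth_rw 1 [hU]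
        refine (mul_measure_biUnion_le hD (fun t _ => hEm n t)
          (H := fun t => {ω | S ω ≤ (t + h n : ℝ≥0)}) (fun t _ => hm _) fun t _ B hB hBE =>
            ofReal_mul_measure_le_of_le_condExp (𝓕.le t) (hm _) hB hBE).trans (measure_mono ?_)
        rintro ω ⟨⟨t, ht, htE⟩, hω⟩
        refine ⟨(entryTime_le ht htE).trans_lt ENNReal.coe_lt_top, fun _ => ?_⟩
        by_contra hlt
        obtain ⟨s, -, -, hs, hslt⟩ := hω _ (lt_tsub_iff_right.2 (not_le.1 hlt))
        refine absurd (lt_tsub_iff_right.1 hslt) (not_lt.2 ?_)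
        simpa using hs
      have hcompl : c * P {ω | R n ω < ⊤}ᶜ ≤ P (Q n \ {ω | R n ω < ⊤}) := by
        refine (mul_le_of_le_one_left zero_le hc1).trans (measure_mono fun ω hω => ?_)
        exact ⟨fun h' => absurd h' hω, hω⟩
      calc c = c * (P {ω | R n ω < ⊤} + P {ω | R n ω < ⊤}ᶜ) := by
            rw [measure_add_measure_compl (hfin n), measure_univ, mul_one]
        _ ≤ P ({ω | R n ω < ⊤} ∩ Q n) + P (Q n \ {ω | R n ω < ⊤}) := by
            rw [mul_add]; exact add_le_add hentry hcompl
        _ = P (Q n) := by rw [Set.inter_comm, measure_inter_add_sdiff _ (hfin n)]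
    have hc1 : Tendsto (fun n => ENNReal.ofReal (1 - h n)) atTop (𝓝 1) := by
      have : Tendsto (fun n => (1 : ℝ) - h n) atTop (𝓝 (1 - (0 : ℝ≥0))) :=
        tendsto_const_nhds.sub ((NNReal.tendsto_coe).2 hlim)
      simpa using ENNReal.tendsto_ofReal this
    filter_upwards [mem_limsup_ae hQm hc1 hle] with ω hω
    rcases eq_or_ne (⨆ k, R k ω) ⊤ with htop | htop
    · rw [htop]; exact le_top
    · have hlim' : Tendsto (fun n => (⨆ k, R k ω) + (h n : ℝ≥0∞)) atTop
          (𝓝 ((⨆ k, R k ω) + ((0 : ℝ≥0) : ℝ≥0∞))) :=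
        tendsto_const_nhds.add (ENNReal.tendsto_coe.2 hlim)
      rw [ENNReal.coe_zero, add_zero] at hlim'
      refine le_of_not_gt fun hlt => ?_
      obtain ⟨n, hn, hn'⟩ := (hω.and_eventually (hlim'.eventually (gt_mem_nhds hlt))).exists
      have hle := le_iSup (fun k => R k ω) n
      exact absurd ((hn (hle.trans_lt htop.lt_top)).trans (add_le_add_left hle _)) (not_le.2 hn')
  have hlt : ∀ᵐ ω ∂P, 0 < S ω → S ω < ⊤ → ∀ n, R n ω < S ω := by
    have h1 : ∀ᵐ ω ∂P, ∀ n, ∀ q ∈ D, ∃ f : ℝ≥0 → ℝ, Continuous f ∧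
        ∀ t ∈ D, (P⟦{ω | S ω ≤ (q + h n : ℝ≥0)} | 𝓕 t⟧) ω = f t :=
      ae_all_iff.2 fun n => (ae_ball_iff hD).2 fun q _ => hC.exists_continuous _ hD
    have h2 : ∀ᵐ ω ∂P, ∀ n, ∀ q ∈ D, ∀ t ∈ D, t ≤ q + h n → S ω < t →
        1 ≤ (P⟦{ω | S ω ≤ (q + h n : ℝ≥0)} | 𝓕 t⟧) ω := by
      refine ae_all_iff.2 fun n => (ae_ball_iff hD).2 fun q _ => (ae_ball_iff hD).2 fun t _ => ?_
      by_cases hle : t ≤ q + h n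
      · have := condExp_indicator_mono (P := P) (𝓕.le t _ (hS t)) (hm (q + h n))
          (fun ω (hω : S ω < t) => hω.le.trans (ENNReal.coe_le_coe.2 hle)) (𝓕 t)
        rw [condExp_indicator_self (𝓕.le t) (hS t)] at this
        filter_upwards [this] with ω hω _ hlt
        rwa [Set.indicator_of_mem (show ω ∈ {ω | S ω < t} from hlt)] at hω
      · exact Eventually.of_forall fun ω h => absurd h hle
    have h3 : ∀ᵐ ω ∂P, ∀ n, ∀ q ∈ D, ∀ t ∈ D, q ≤ t →
        (P⟦{ω | S ω ≤ (q + h n : ℝ≥0)} | 𝓕 t⟧) ω ≤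
          (P⟦{ω | S ω ≤ (t + h n : ℝ≥0)} | 𝓕 t⟧) ω := by
      refine ae_all_iff.2 fun n => (ae_ball_iff hD).2 fun q _ => (ae_ball_iff hD).2 fun t _ => ?_
      by_cases hle : q ≤ t
      · filter_upwards [condExp_indicator_mono (P := P) (hm (q + h n)) (hm (t + h n))
          (fun ω hω => le_trans hω (ENNReal.coe_le_coe.2 (by gcongr))) (𝓕 t)] with ω hω _ using hω
      · exact Eventually.of_forall fun ω h => absurd h hle
    filter_upwards [h1, h2, h3] with ω h1 h2 h3 hS0 hStop n
    obtain ⟨s, hs⟩ : ∃ s : ℝ≥0, S ω = s := ⟨_, (ENNReal.coe_toNNReal hStop.ne).symm⟩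
    rw [hs] at hS0 h2 ⊢
    have hs0 : 0 < s := by exact_mod_cast hS0
    -- Fixing the horizon q + `h n`, which lies beyond s, replaces the moving horizon t + `h n` by a
    -- single martingale with continuous paths.
    obtain ⟨q, hqD, hq1, hq2⟩ := hdense.exists_between
      (show s - h n < s from tsub_lt_self hs0 (hpos n))
    have hsq : s < q + h n := lt_add_of_tsub_lt_right hq1
    obtain ⟨f, hf, hfq⟩ := h1 n q hqD
    -- Just after s the martingale already knows that S has occurred, so it is at least 1 there, and
    -- continuity carries this back to s. It therefore exceeds 1 - `h n` slightly before s, which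
    -- forces `R n` < S.
    have hfs : 1 ≤ f s := by
      by_contra! hlt
      have hev : ∀ᶠ t in 𝓝 s, f t < 1 ∧ t < q + h n :=
        (hf.continuousAt.eventually (gt_mem_nhds hlt)).and (gt_mem_nhds hsq)
      obtain ⟨u, hsu, hu⟩ := exists_Ico_subset_of_mem_nhds hev ⟨s + 1, by simp⟩
      obtain ⟨t, htD, ht1, ht2⟩ := hdense.exists_between hsu
      obtain ⟨ht3, ht4⟩ := hu ⟨ht1.le, ht2⟩
      refine absurd ht3 (not_lt.2 ?_)
      rw [← hfq t htD]
      exact h2 n q hqD t htD ht4.le (by exact_mod_cast ht1)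
    have hev : ∀ᶠ t in 𝓝 s, 1 - (h n : ℝ) < f t ∧ q < t :=
      (hf.continuousAt.eventually (lt_mem_nhds (lt_of_lt_of_le
        (sub_lt_self 1 (NNReal.coe_pos.2 (hpos n))) hfs))).and (lt_mem_nhds hq2)
    obtain ⟨u, hus, hu⟩ := exists_Ioc_subset_of_mem_nhds hev ⟨0, hs0⟩
    obtain ⟨t, htD, ht1, ht2⟩ := hdense.exists_between hus
    obtain ⟨ht3, ht4⟩ := hu ⟨ht1, ht2.le⟩
    refine entryTime_lt_iff.2 ⟨t, htD, ?_, by exact_mod_cast ht2⟩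
    rw [← hfq t htD] at ht3
    exact ht3.trans_le (h3 n q hqD t htD ht4.le)
  filter_upwards [hge, hlt] with ω hge hlt h0 htop
  have heq : S ω = ⨆ k, R k ω := le_antisymm hge (iSup_le fun n => (hlt h0 htop n).le)
  have : ∀ n, R n ω < ⨆ k, R k ω := fun n => heq ▸ hlt h0 htop n
  rw [if_pos this, heq]

theorem AvoidsStoppingTimes.ae_ne {G : Ω → ℝ≥0∞} (hA : AvoidsStoppingTimes P 𝓕 G) (a : ℝ≥0∞) :
    ∀ᵐ ω ∂P, G ω ≠ a := by
  rw [ae_iff]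
  simpa using hA (fun _ => a) fun t => MeasurableSet.const (a ≤ (t : ℝ≥0∞))

/-- The values 0 and ∞, where an optional time need not be announced, are excluded by applying (A)
to constant times. -/
theorem AvoidsStoppingTimes.ae_ne_optionalTime [IsProbabilityMeasure P]
    (hC : AllMartingalesContinuous P 𝓕) {G : Ω → ℝ≥0∞} (hA : AvoidsStoppingTimes P 𝓕 G)
    {S : Ω → ℝ≥0∞} (hS : IsOptionalTime 𝓕 S) : ∀ᵐ ω ∂P, G ω ≠ S ω := by
  obtain ⟨T, hT, hST⟩ := hC.exists_isStoppingTime hS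
  have hne : ∀ᵐ ω ∂P, G ω ≠ T ω := by
    rw [ae_iff]
    simpa using hA T hT
  filter_upwards [hST, hne, hA.ae_ne 0, hA.ae_ne ⊤] with ω h1 h2 h3 h4 h5
  rcases eq_or_ne (S ω) 0 with h0 | h0
  · exact h3 (h5.trans h0)
  rcases eq_or_ne (S ω) ⊤ with htop | htop
  · exact h4 (h5.trans htop)
  exact h2 (h5.trans (h1 (pos_iff_ne_zero.2 h0) htop.lt_top))

end Announcing

/-! ### Construction of a continuous version of the Azéma supermartingale. -/

section Existence

variable {Ω : Type*} {m : MeasurableSpace Ω} {P : Measure Ω} {𝓕 : Filtration ℝ≥0 m}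

/-- The conditional probability that `G` falls into a short interval is small, uniformly over the
left end point of the interval. -/
theorem ae_forall_condExp_Ioc_le [IsProbabilityMeasure P] (hC : AllMartingalesContinuous P 𝓕)
    {G : Ω → ℝ≥0∞} (hG : Measurable G) (hA : AvoidsStoppingTimes P 𝓕 G) {D : Set ℝ≥0}
    (hD : D.Countable) {h : ℕ → ℝ≥0} (hanti : Antitone h) (hlim : Tendsto h atTop (𝓝 0))
    {ε : ℝ} (hε : 0 < ε) :
    ∀ᵐ ω ∂P, ∃ n, ∀ t ∈ D, (P⟦{ω | (t : ℝ≥0∞) < G ω ∧ G ω ≤ (t + h n : ℝ≥0)} | 𝓕 t⟧) ω ≤ ε := by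
  set H : ℕ → ℝ≥0 → Set Ω := fun n t => {ω | (t : ℝ≥0∞) < G ω ∧ G ω ≤ (t + h n : ℝ≥0)} with hH
  have hHm : ∀ n t, MeasurableSet (H n t) := fun n t =>
    (measurableSet_lt measurable_const hG).inter (measurableSet_le hG measurable_const)
  set E : ℕ → ℝ≥0 → Set Ω := fun n t => {ω | ε < (P⟦H n t | 𝓕 t⟧) ω} with hE
  have hEm : ∀ n t, MeasurableSet[𝓕 t] (E n t) := fun n t =>
    measurableSet_lt measurable_const stronglyMeasurable_condExp.measurable
  set S : ℕ → Ω → ℝ≥0∞ := fun n => entryTime D (E n) with hS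
  have hSopt : ∀ n, IsOptionalTime 𝓕 (S n) := fun n =>
    isOptionalTime_entryTime hD fun t _ => hEm n t
  -- Shorter intervals carry less conditional probability, so the level ε is exceeded later.
  have hSmono : ∀ᵐ ω ∂P, Monotone fun n => S n ω := by
    have h1 : ∀ᵐ ω ∂P, ∀ n, ∀ t ∈ D, (P⟦H (n + 1) t | 𝓕 t⟧) ω ≤ (P⟦H n t | 𝓕 t⟧) ω :=
      ae_all_iff.2 fun n => (ae_ball_iff hD).2 fun t _ =>
        condExp_indicator_mono (hHm _ _) (hHm _ _) (fun ω hω => ⟨hω.1, hω.2.trans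
          (ENNReal.coe_le_coe.2 (add_le_add_right (hanti n.le_succ) t))⟩) (𝓕 t)
    filter_upwards [h1] with ω hω
    refine monotone_nat_of_le_succ fun n => le_iInf₂ fun t ht => ?_
    exact entryTime_le ht.1 (lt_of_lt_of_le (show ε < _ from ht.2) (hω n t ht.1))
  set Q : ℕ → Set Ω := fun n => {ω | S n ω ≤ G ω ∧ G ω ≤ S n ω + h n} with hQ
  have hQm : ∀ n, MeasurableSet (Q n) := fun n =>
    (measurableSet_le (hSopt n).measurable hG).inter
      (measurableSet_le hG ((hSopt n).measurable.add_const _))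
  have hbound : ∀ n, ENNReal.ofReal ε * P (⋃ t ∈ D, E n t) ≤ P (Q n) := by
    intro n
    refine (mul_measure_biUnion_le hD (fun t _ => hEm n t) (fun t _ => hHm n t)
      fun t _ B hB hBE => ofReal_mul_measure_le_of_le_condExp (𝓕.le t) (hHm n t) hB hBE).trans
        (measure_mono ?_)
    rintro ω ⟨⟨t, ht, htE⟩, hω⟩
    have hfin : S n ω < ⊤ := (entryTime_le ht htE).trans_lt ENNReal.coe_lt_top
    constructor
    · obtain ⟨s, hs, hsE, hsH, -⟩ := hω _ hfin
      exact (entryTime_le hs hsE).trans hsH.1.le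
    · by_contra hlt
      obtain ⟨s, -, -, hs, hslt⟩ := hω _ (lt_tsub_iff_right.2 (not_le.1 hlt))
      refine absurd (lt_tsub_iff_right.1 hslt) (not_lt.2 ?_)
      simpa using hs.2
  -- If `S n` ≤ G ≤ `S n` + `h n` for infinitely many n, then G is the supremum of the increasing `S
  -- n`. This is an optional time, which G almost surely avoids.
  have hzero : P (⋂ n, ⋃ t ∈ D, E n t) = 0 := by
    have h1 : ENNReal.ofReal ε * P (⋂ n, ⋃ t ∈ D, E n t) ≤ P {ω | ∃ᶠ n in atTop, ω ∈ Q n} :=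
      le_measure_frequently (fun n => (hQm n).nullMeasurableSet) <| Eventually.of_forall fun n =>
        (mul_le_mul_right (measure_mono (Set.iInter_subset _ n)) _).trans (hbound n)
    have h2 : P {ω | ∃ᶠ n in atTop, ω ∈ Q n} = 0 := by
      have hne := hA.ae_ne_optionalTime hC (IsOptionalTime.iSup hSopt)
      have : ∀ᵐ ω ∂P, ¬ ∃ᶠ n in atTop, ω ∈ Q n := by
        filter_upwards [hne, hSmono] with ω hne hmono hfreq
        refine hne (le_antisymm ?_ (iSup_le fun n => ?_))
        · have hlim' : Tendsto (fun n => (⨆ k, S k ω) + (h n : ℝ≥0∞)) atTop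
              (𝓝 ((⨆ k, S k ω) + ((0 : ℝ≥0) : ℝ≥0∞))) :=
            tendsto_const_nhds.add (ENNReal.tendsto_coe.2 hlim)
          rw [ENNReal.coe_zero, add_zero] at hlim'
          refine le_of_not_gt fun hlt => ?_
          obtain ⟨n, hn, hn'⟩ :=
            (hfreq.and_eventually (hlim'.eventually (gt_mem_nhds hlt))).exists
          exact absurd (hn.2.trans (add_le_add_left (le_iSup (fun k => S k ω) n) _))
            (not_le.2 hn')
        · obtain ⟨k, hk, hnk⟩ := (hfreq.and_eventually (eventually_ge_atTop n)).exists
          exact (hmono hnk).trans hk.1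
      rw [ae_iff] at this
      simpa only [not_not] using this
    rw [h2, nonpos_iff_eq_zero, mul_eq_zero] at h1
    exact h1.resolve_left (by simpa using hε)
  have : ∀ᵐ ω ∂P, ω ∉ ⋂ n, ⋃ t ∈ D, E n t := measure_eq_zero_iff_ae_notMem.1 hzero
  filter_upwards [this] with ω hω
  simp only [Set.mem_iInter, not_forall, Set.mem_iUnion, not_exists] at hω
  obtain ⟨n, hn⟩ := hω
  exact ⟨n, fun t ht => not_lt.1 (hn t ht)⟩

/-- Along a countable dense set of times, the Azéma supermartingale has limits everywhere. -/
theorem ae_exists_tendsto_azema [IsProbabilityMeasure P] (hC : AllMartingalesContinuous P 𝓕)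
    {G : Ω → ℝ≥0∞} (hG : Measurable G) (hA : AvoidsStoppingTimes P 𝓕 G) {D : Set ℝ≥0}
    (hD : D.Countable) (hdense : Dense D) :
    ∀ᵐ ω ∂P, ∀ t, ∃ l, Tendsto (fun s : ℝ≥0 => (P⟦{ω | (s : ℝ≥0∞) < G ω} | 𝓕 s⟧) ω)
      (𝓝[D] t) (𝓝 l) := by
  set h : ℕ → ℝ≥0 := fun n => 1 / ((n : ℝ≥0) + 1) with hh
  have hpos : ∀ n, 0 < h n := fun n => by positivity
  have hlim : Tendsto h atTop (𝓝 0) := tendsto_one_div_add_atTop_nhds_zero_nat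
  have hanti : Antitone h := fun i j hij => by
    simp only [hh]
    gcongr
  have hGm : ∀ s : ℝ≥0, MeasurableSet {ω | (s : ℝ≥0∞) < G ω} := fun s =>
    measurableSet_lt measurable_const hG
  have hHm : ∀ n (t : ℝ≥0),
      MeasurableSet {ω | (t : ℝ≥0∞) < G ω ∧ G ω ≤ (t + h n : ℝ≥0)} := fun n t =>
    (hGm t).inter (measurableSet_le hG measurable_const)
  have h1 : ∀ᵐ ω ∂P, ∀ k : ℕ, ∃ n, ∀ t ∈ D,
      (P⟦{ω | (t : ℝ≥0∞) < G ω ∧ G ω ≤ (t + h n : ℝ≥0)} | 𝓕 t⟧) ω ≤ 1 / ((k : ℝ) + 1) :=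
    ae_all_iff.2 fun k => ae_forall_condExp_Ioc_le hC hG hA hD hanti hlim (by positivity)
  have h2 : ∀ᵐ ω ∂P, ∀ r ∈ D, ∃ f : ℝ≥0 → ℝ, Continuous f ∧
      ∀ t ∈ D, (P⟦{ω | (r : ℝ≥0∞) < G ω} | 𝓕 t⟧) ω = f t :=
    (ae_ball_iff hD).2 fun r _ => hC.exists_continuous _ hD
  have h3 : ∀ᵐ ω ∂P, ∀ n, ∀ q ∈ D, ∀ r ∈ D, q ≤ r → r ≤ q + h n →
      |(P⟦{ω | (q : ℝ≥0∞) < G ω} | 𝓕 q⟧) ω - (P⟦{ω | (r : ℝ≥0∞) < G ω} | 𝓕 q⟧) ω| ≤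
        (P⟦{ω | (q : ℝ≥0∞) < G ω ∧ G ω ≤ (q + h n : ℝ≥0)} | 𝓕 q⟧) ω := by
    refine ae_all_iff.2 fun n => (ae_ball_iff hD).2 fun q _ => (ae_ball_iff hD).2 fun r _ => ?_
    by_cases hqr : q ≤ r ∧ r ≤ q + h n
    · have hmono := condExp_indicator_mono (P := P) (hGm r) (hGm q)
        (fun ω hω => lt_of_le_of_lt (ENNReal.coe_le_coe.2 hqr.1) hω) (𝓕 q)
      have hadd := condExp_add (integrable_indicator_one (P := P) (hGm r))
        (integrable_indicator_one (P := P) (hHm n q)) (𝓕 q)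
      have hle : P⟦{ω | (q : ℝ≥0∞) < G ω} | 𝓕 q⟧ ≤ᵐ[P]
          P[({ω | (r : ℝ≥0∞) < G ω}.indicator fun _ => (1 : ℝ)) +
            ({ω | (q : ℝ≥0∞) < G ω ∧ G ω ≤ (q + h n : ℝ≥0)}.indicator fun _ => (1 : ℝ)) | 𝓕 q] := by
        refine condExp_mono (integrable_indicator_one (hGm q))
          ((integrable_indicator_one (hGm r)).add (integrable_indicator_one (hHm n q)))
          (Eventually.of_forall fun ω => ?_)
        by_cases hq : (q : ℝ≥0∞) < G ω
        · by_cases hr : (r : ℝ≥0∞) < G ω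
          · simp [Set.indicator, hq, hr]
            split_ifs <;> simp
          · have : G ω ≤ (q + h n : ℝ≥0) := (not_lt.1 hr).trans (ENNReal.coe_le_coe.2 hqr.2)
            rw [Pi.add_apply, Set.indicator_of_mem (show ω ∈ {ω | (q : ℝ≥0∞) < G ω} from hq),
              Set.indicator_of_mem (show ω ∈ {ω | (q : ℝ≥0∞) < G ω ∧ G ω ≤ (q + h n : ℝ≥0)} from
                ⟨hq, this⟩), Set.indicator_of_notMem (show ω ∉ {ω | (r : ℝ≥0∞) < G ω} from hr)]
            norm_num
        · rw [Set.indicator_of_notMem (show ω ∉ {ω | (q : ℝ≥0∞) < G ω} from hq)]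
          exact add_nonneg (Set.indicator_nonneg (fun _ _ => zero_le_one) _)
            (Set.indicator_nonneg (fun _ _ => zero_le_one) _)
      filter_upwards [hmono, hadd, hle] with ω hmono hadd hle _ _
      rw [hadd, Pi.add_apply] at hle
      rw [abs_of_nonneg (sub_nonneg.2 hmono)]
      linarith
    · exact Eventually.of_forall fun ω ha hb => absurd ⟨ha, hb⟩ hqr
  filter_upwards [h1, h2, h3] with ω h1 h2 h3 t
  have hne : (𝓝[D] t).NeBot := mem_closure_iff_nhdsWithin_neBot.1 (hdense t)
  refine cauchy_map_iff_exists_tendsto.1 (Metric.cauchy_iff.2 ⟨hne.map _, fun ε hε => ?_⟩)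
  obtain ⟨k, hk⟩ := exists_nat_one_div_lt (show 0 < ε / 4 by positivity)
  obtain ⟨n, hn⟩ := h1 k
  -- With r between t + h/3 and t + h/2, every q close enough to t satisfies q < r < q + h,
  -- whichever side of t it lies on.
  obtain ⟨r, hrD, hr1, hr2⟩ := hdense.exists_between
    (show t + h n / 3 < t + h n / 2 from
      add_lt_add_right (div_lt_div_of_pos_left (hpos n) (by norm_num) (by norm_num)) t)
  obtain ⟨f, hf, hfr⟩ := h2 r hrD
  have hev : ∀ᶠ q in 𝓝[D] t,
      |(P⟦{ω | (q : ℝ≥0∞) < G ω} | 𝓕 q⟧) ω - f t| < ε / 2 := by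
    have e1 : ∀ᶠ q in 𝓝 t, q < r := gt_mem_nhds (lt_of_le_of_lt le_self_add hr1)
    have e2 : ∀ᶠ q in 𝓝 t, r < q + h n := by
      refine (continuous_add_const (h n)).continuousAt.eventually (lt_mem_nhds (hr2.trans ?_))
      exact add_lt_add_right (half_lt_self (hpos n)) t
    have e3 : ∀ᶠ q in 𝓝 t, |f q - f t| < ε / 4 := by
      have := hf.continuousAt.eventually (Metric.ball_mem_nhds (f t) (show 0 < ε / 4 by positivity))
      simpa only [Metric.mem_ball, Real.dist_eq] using this
    filter_upwards [nhdsWithin_le_nhds e1, nhdsWithin_le_nhds e2, nhdsWithin_le_nhds e3,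
      self_mem_nhdsWithin] with q e1 e2 e3 hqD
    have e4 := (h3 n q hqD r hrD e1.le e2.le).trans (hn q hqD)
    rw [hfr q hqD] at e4
    calc _ ≤ _ := abs_sub_le _ (f q) _
      _ < ε / 2 := by linarith
  refine ⟨_, image_mem_map hev, ?_⟩
  rintro _ ⟨x, hx, rfl⟩ _ ⟨y, hy, rfl⟩
  rw [Real.dist_eq]
  have hx' : |(P⟦{ω | (x : ℝ≥0∞) < G ω} | 𝓕 x⟧) ω - f t| < ε / 2 := hx
  have hy' : |(P⟦{ω | (y : ℝ≥0∞) < G ω} | 𝓕 y⟧) ω - f t| < ε / 2 := hy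
  have := abs_sub_le ((P⟦{ω | (x : ℝ≥0∞) < G ω} | 𝓕 x⟧) ω) (f t)
    ((P⟦{ω | (y : ℝ≥0∞) < G ω} | 𝓕 y⟧) ω)
  rw [abs_sub_comm (f t)] at this
  linarith

/-- The largest multiple of `1 / (n + 1)` below `t`. -/
noncomputable def gridFloor (n : ℕ) (t : ℝ≥0) : ℝ≥0 := ⌊t * (n + 1)⌋₊ / (n + 1)

theorem gridFloor_le (n : ℕ) (t : ℝ≥0) : gridFloor n t ≤ t :=
  div_le_of_le_mul₀ (by positivity) zero_le (Nat.floor_le zero_le)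

theorem tendsto_gridFloor (t : ℝ≥0) : Tendsto (fun n => gridFloor n t) atTop (𝓝 t) := by
  refine NNReal.tendsto_coe.1 ?_
  have h2 : Tendsto (fun n : ℕ => (n : ℝ) + 1) atTop atTop :=
    tendsto_atTop_add_const_right _ _ tendsto_natCast_atTop_atTop
  refine ((tendsto_nat_floor_mul_div_atTop t.coe_nonneg).comp h2).congr fun n => ?_
  simp only [Function.comp, gridFloor, NNReal.coe_div, NNReal.coe_add, NNReal.coe_natCast,
    NNReal.coe_one]
  congr 2

/-- The multiples of all `1 / (n + 1)`. -/
def gridTimes : Set ℝ≥0 := Set.range fun p : ℕ × ℕ => (p.1 : ℝ≥0) / (p.2 + 1)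

theorem gridFloor_mem_gridTimes (n : ℕ) (t : ℝ≥0) : gridFloor n t ∈ gridTimes :=
  ⟨(⌊t * (n + 1)⌋₊, n), rfl⟩

theorem countable_gridTimes : gridTimes.Countable := Set.countable_range _

theorem dense_gridTimes : Dense gridTimes := fun t =>
  mem_closure_of_tendsto (tendsto_gridFloor t)
    (Eventually.of_forall fun n => gridFloor_mem_gridTimes n t)

theorem exists_isContinuousAzema [IsProbabilityMeasure P] (hC : AllMartingalesContinuous P 𝓕)
    {G : Ω → ℝ≥0∞} (hG : Measurable G) (hA : AvoidsStoppingTimes P 𝓕 G) :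
    ∃ Z, IsContinuousAzema P 𝓕 G Z := by
  set z : Ω → ℝ≥0 → ℝ := fun ω s => (P⟦{ω | (s : ℝ≥0∞) < G ω} | 𝓕 s⟧) ω with hz
  have hgrid : ∀ t, Tendsto (fun n => gridFloor n t) atTop (𝓝[gridTimes] t) := fun t =>
    tendsto_nhdsWithin_iff.2 ⟨tendsto_gridFloor t,
      Eventually.of_forall fun n => gridFloor_mem_gridTimes n t⟩
  have hlim := ae_exists_tendsto_azema hC hG hA countable_gridTimes dense_gridTimes
  -- Grid times approaching t from below make the limsup measurable at time t for every ω, without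
  -- completing the filtration.
  refine ⟨fun t ω => limsup (fun n => z ω (gridFloor n t)) atTop, fun t => ?_, fun t => ?_, ?_⟩
  · have : ∀ n, Measurable[𝓕 t] fun ω => z ω (gridFloor n t) := fun n =>
      (stronglyMeasurable_condExp.mono (𝓕.mono (gridFloor_le n t))).measurable
    exact (Measurable.limsup this).stronglyMeasurable
  -- Adding t itself to the dense set forces the limit at t to equal the conditional probability at
  -- t.
  · have hlim' := ae_exists_tendsto_azema hC hG hA (countable_gridTimes.insert t)
      (dense_gridTimes.mono (Set.subset_insert t _))
    filter_upwards [hlim'] with ω h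
    obtain ⟨l, hl⟩ := h t
    have h1 : l = z ω t := tendsto_nhds_unique
      (hl.mono_left (pure_le_nhdsWithin (Set.mem_insert t _))) (tendsto_pure_nhds (z ω) t)
    have h2 := hl.comp ((hgrid t).mono_right (nhdsWithin_mono t (Set.subset_insert t _)))
    rw [h1] at h2
    exact h2.limsup_eq
  · filter_upwards [hlim] with ω h
    have heq : (fun t => limsup (fun n => z ω (gridFloor n t)) atTop) =
        extendFrom gridTimes (z ω) :=
      funext fun t => ((tendsto_extendFrom (h t)).comp (hgrid t)).limsup_eq
    rw [heq]
    exact continuous_extendFrom dense_gridTimes h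

end Existence

/-! ### Path properties of a continuous version, and stopping near 1/2. -/

section ContinuousAzema

variable {Ω : Type*} {m : MeasurableSpace Ω} {P : Measure Ω} {𝓕 : Filtration ℝ≥0 m}

theorem IsContinuousAzema.congr {G G' : Ω → ℝ≥0∞} (h : G =ᵐ[P] G') {Z : ℝ≥0 → Ω → ℝ}
    (hZ : IsContinuousAzema P 𝓕 G Z) : IsContinuousAzema P 𝓕 G' Z := by
  refine ⟨hZ.1, fun t => (hZ.2.1 t).trans (condExp_congr_ae ?_), hZ.2.2⟩
  filter_upwards [h] with ω hω
  simp only [Set.indicator, Set.mem_ofPred_eq, hω]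

theorem AvoidsStoppingTimes.congr {G G' : Ω → ℝ≥0∞} (h : G =ᵐ[P] G')
    (hA : AvoidsStoppingTimes P 𝓕 G) : AvoidsStoppingTimes P 𝓕 G' := fun T hT => by
  rw [← hA T hT]
  refine measure_congr ?_
  filter_upwards [h] with ω hω
  exact congrArg (· = T ω) hω.symm

namespace IsContinuousAzema

variable {G : Ω → ℝ≥0∞} {Z : ℝ≥0 → Ω → ℝ}

theorem ae_mem_Icc [IsProbabilityMeasure P] (hZ : IsContinuousAzema P 𝓕 G Z) (hG : Measurable G) :
    ∀ᵐ ω ∂P, ∀ t, Z t ω ∈ Set.Icc (0 : ℝ) 1 := by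
  have h1 : ∀ᵐ ω ∂P, ∀ t ∈ gridTimes, Z t ω ∈ Set.Icc (0 : ℝ) 1 := by
    refine (ae_ball_iff countable_gridTimes).2 fun t _ => ?_
    have hm : MeasurableSet {ω | (t : ℝ≥0∞) < G ω} := measurableSet_lt measurable_const hG
    have h0 := condExp_indicator_mono (P := P) MeasurableSet.empty hm (Set.empty_subset _) (𝓕 t)
    have h1 := condExp_indicator_mono (P := P) hm MeasurableSet.univ (Set.subset_univ _) (𝓕 t)
    rw [condExp_indicator_self (𝓕.le t) (@MeasurableSet.empty Ω (𝓕 t))] at h0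
    rw [condExp_indicator_self (𝓕.le t) (@MeasurableSet.univ Ω (𝓕 t))] at h1
    filter_upwards [h0, h1, hZ.2.1 t] with ω h0 h1 h2
    rw [h2]
    exact ⟨by simpa using h0, by simpa using h1⟩
  filter_upwards [h1, hZ.2.2] with ω h1 h2 t
  have hcl : IsClosed {t | Z t ω ∈ Set.Icc (0 : ℝ) 1} := isClosed_Icc.preimage h2
  exact hcl.closure_subset_iff.2 h1 (dense_gridTimes t)

theorem ae_zero_eq_one [IsProbabilityMeasure P] (hZ : IsContinuousAzema P 𝓕 G Z)
    (hA : AvoidsStoppingTimes P 𝓕 G) : ∀ᵐ ω ∂P, Z 0 ω = 1 := by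
  have h1 : ({ω | ((0 : ℝ≥0) : ℝ≥0∞) < G ω}.indicator fun _ => (1 : ℝ)) =ᵐ[P] fun _ => 1 := by
    filter_upwards [hA.ae_ne 0] with ω hω
    exact Set.indicator_of_mem (by simpa using pos_iff_ne_zero.2 hω) _
  have h2 := condExp_congr_ae (m := 𝓕 0) h1
  rw [condExp_const (𝓕.le 0)] at h2
  filter_upwards [h2, hZ.2.1 0] with ω h2 h3
  rw [h3, h2]

/-- The entry inequality gives ε P(Z exceeds ε at some grid time ≥ n) ≤ P(G > n), and the right side
tends to 0 because G is almost surely finite. -/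
theorem ae_tendsto_zero [IsProbabilityMeasure P] (hZ : IsContinuousAzema P 𝓕 G Z)
    (hG : Measurable G) (hA : AvoidsStoppingTimes P 𝓕 G) :
    ∀ᵐ ω ∂P, Tendsto (fun t => Z t ω) atTop (𝓝 0) := by
  have hm : ∀ t : ℝ≥0, MeasurableSet {ω | (t : ℝ≥0∞) < G ω} := fun t =>
    measurableSet_lt measurable_const hG
  have key : ∀ ε : ℝ, 0 < ε → ∀ᵐ ω ∂P, ∃ n : ℕ, ∀ t ∈ gridTimes, (n : ℝ≥0) ≤ t →
      (P⟦{ω | (t : ℝ≥0∞) < G ω} | 𝓕 t⟧) ω ≤ ε := by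
    intro ε hε
    set E : ℝ≥0 → Set Ω := fun t => {ω | ε < (P⟦{ω | (t : ℝ≥0∞) < G ω} | 𝓕 t⟧) ω} with hE
    have hEm : ∀ t, MeasurableSet[𝓕 t] (E t) := fun t =>
      measurableSet_lt measurable_const stronglyMeasurable_condExp.measurable
    set D : ℕ → Set ℝ≥0 := fun n => {t ∈ gridTimes | (n : ℝ≥0) ≤ t} with hD
    have hbound : ∀ n : ℕ, ENNReal.ofReal ε * P (⋃ t ∈ D n, E t) ≤
        P {ω | ((n : ℝ≥0) : ℝ≥0∞) < G ω} := fun n => by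
      refine (mul_measure_biUnion_le (countable_gridTimes.mono fun t ht => ht.1)
        (fun t _ => hEm t) (fun t _ => hm t) fun t _ B hB hBE =>
          ofReal_mul_measure_le_of_le_condExp (𝓕.le t) (hm t) hB hBE).trans (measure_mono ?_)
      rintro ω ⟨⟨t, ht, htE⟩, hω⟩
      obtain ⟨s, hs, -, hsG, -⟩ := hω ⊤ ((entryTime_le ht htE).trans_lt ENNReal.coe_lt_top)
      exact lt_of_le_of_lt (ENNReal.coe_le_coe.2 hs.2) hsG
    have hzero : P (⋂ n, ⋃ t ∈ D n, E t) = 0 := by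
      have h1 : ENNReal.ofReal ε * P (⋂ n, ⋃ t ∈ D n, E t) ≤
          P {ω | ∃ᶠ n : ℕ in atTop, ω ∈ {ω | ((n : ℝ≥0) : ℝ≥0∞) < G ω}} :=
        le_measure_frequently (fun n => (hm n).nullMeasurableSet) <|
          Eventually.of_forall fun n =>
            (mul_le_mul_right (measure_mono (Set.iInter_subset _ n)) _).trans (hbound n)
      have h2 : ∀ᵐ ω ∂P, ¬ ∃ᶠ n : ℕ in atTop, ω ∈ {ω | ((n : ℝ≥0) : ℝ≥0∞) < G ω} := by
        filter_upwards [hA.ae_ne ⊤] with ω hω hfreq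
        obtain ⟨k, hk⟩ := ENNReal.exists_nat_gt hω
        obtain ⟨n, hn, hkn⟩ := (hfreq.and_eventually (eventually_ge_atTop k)).exists
        have hn' : (n : ℝ≥0∞) < G ω := by simpa using hn
        exact absurd (hn'.trans hk) (not_lt.2 (by exact_mod_cast hkn))
      rw [ae_iff] at h2
      simp only [not_not] at h2
      rw [h2, nonpos_iff_eq_zero, mul_eq_zero] at h1
      exact h1.resolve_left (by simpa using hε)
    filter_upwards [measure_eq_zero_iff_ae_notMem.1 hzero] with ω hω
    simp only [Set.mem_iInter, not_forall, Set.mem_iUnion, not_exists] at hω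
    obtain ⟨n, hn⟩ := hω
    exact ⟨n, fun t ht hnt => not_lt.1 (hn t ⟨ht, hnt⟩)⟩
  have h1 : ∀ᵐ ω ∂P, ∀ k : ℕ, ∃ n : ℕ, ∀ t ∈ gridTimes, (n : ℝ≥0) ≤ t →
      (P⟦{ω | (t : ℝ≥0∞) < G ω} | 𝓕 t⟧) ω ≤ 1 / ((k : ℝ) + 1) :=
    ae_all_iff.2 fun k => key _ (by positivity)
  filter_upwards [h1, (ae_ball_iff countable_gridTimes).2 fun t _ => hZ.2.1 t, hZ.2.2,
    hZ.ae_mem_Icc hG] with ω h1 h2 h3 h4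
  refine Metric.tendsto_atTop.2 fun ε hε => ?_
  obtain ⟨k, hk⟩ := exists_nat_one_div_lt hε
  obtain ⟨n, hn⟩ := h1 k
  -- The extra 1 makes n < t strict, so the grid times approaching t from below are eventually at
  -- least n.
  refine ⟨n + 1, fun t ht => ?_⟩
  have hnt : (n : ℝ≥0) < t := lt_of_lt_of_le (lt_add_one _) ht
  have hle : Z t ω ≤ 1 / ((k : ℝ) + 1) := by
    refine le_of_tendsto (h3.continuousAt.tendsto.comp (tendsto_gridFloor t)) ?_
    filter_upwards [(tendsto_gridFloor t).eventually (lt_mem_nhds hnt)] with j hj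
    rw [Function.comp, h2 _ (gridFloor_mem_gridTimes j t)]
    exact hn _ (gridFloor_mem_gridTimes j t) hj.le
  rw [Real.dist_eq, sub_zero, abs_of_nonneg (h4 t).1]
  exact hle.trans_lt hk

theorem ae_exists_eq_half [IsProbabilityMeasure P] (hZ : IsContinuousAzema P 𝓕 G Z)
    (hG : Measurable G) (hA : AvoidsStoppingTimes P 𝓕 G) : ∀ᵐ ω ∂P, ∃ t, Z t ω = 1 / 2 := by
  filter_upwards [hZ.ae_zero_eq_one hA, hZ.ae_tendsto_zero hG hA, hZ.2.2] with ω h1 h2 h3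
  obtain ⟨t, ht⟩ := (h2.eventually (gt_mem_nhds (show (0 : ℝ) < 1 / 2 by norm_num))).exists
  exact mem_range_of_exists_le_of_exists_ge h3 ⟨t, ht.le⟩ ⟨0, by rw [h1]; norm_num⟩

theorem ae_iSup_eq [IsProbabilityMeasure P] (hZ : IsContinuousAzema P 𝓕 G Z)
    (hG : Measurable G) (hA : AvoidsStoppingTimes P 𝓕 G) :
    ∀ᵐ ω ∂P, (⨆ t, Z t ω * (1 - Z t ω)) = 1 / 4 := by
  filter_upwards [hZ.ae_exists_eq_half hG hA] with ω ⟨s, hs⟩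
  have hle : ∀ t, Z t ω * (1 - Z t ω) ≤ 1 / 4 := fun t => by nlinarith [sq_nonneg (Z t ω - 1 / 2)]
  refine le_antisymm (ciSup_le hle) ?_
  refine le_trans ?_ (le_ciSup ⟨1 / 4, by rintro _ ⟨t, rfl⟩; exact hle t⟩ s)
  simp only [hs]
  norm_num

theorem ae_valueAt_mem_Icc [IsProbabilityMeasure P] (hZ : IsContinuousAzema P 𝓕 G Z)
    (hG : Measurable G) (hA : AvoidsStoppingTimes P 𝓕 G) (T : Ω → ℝ≥0∞) :
    ∀ᵐ ω ∂P, valueAt Z T ω ∈ Set.Icc (0 : ℝ) 1 := by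
  filter_upwards [hZ.ae_mem_Icc hG, hZ.ae_tendsto_zero hG hA] with ω h1 h2
  rw [valueAt]
  split_ifs
  · rw [h2.limUnder_eq]
    simp
  · exact h1 _

/-- The random index takes countably many values, so no joint measurability of Z in time and ω is
needed. -/
theorem measurable_natCast_div_comp (hZ : StronglyAdapted 𝓕 Z) (n : ℕ) {k : Ω → ℕ}
    (hk : Measurable k) : Measurable fun ω => Z ((k ω : ℝ≥0) / (n + 1)) ω := by
  have h1 : ∀ j : ℕ, Measurable (Z ((j : ℝ≥0) / (n + 1))) := fun j =>
    ((hZ _).mono (𝓕.le _)).measurable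
  have h2 : Measurable fun p : ℕ × Ω => Z ((p.1 : ℝ≥0) / (n + 1)) p.2 :=
    measurable_from_prod_countable_right h1
  exact h2.comp (hk.prodMk measurable_id)

theorem measurable_gridFloor_comp (hZ : StronglyAdapted 𝓕 Z) (n : ℕ) {T : Ω → ℝ≥0}
    (hT : Measurable T) : Measurable fun ω => Z (gridFloor n (T ω)) ω := by
  have hk : Measurable fun ω => ⌊T ω * (n + 1)⌋₊ := Nat.measurable_floor.comp (hT.mul_const _)
  exact measurable_natCast_div_comp hZ n hk

theorem aestronglyMeasurable_valueAt [IsProbabilityMeasure P] (hZ : IsContinuousAzema P 𝓕 G Z)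
    (hG : Measurable G) (hA : AvoidsStoppingTimes P 𝓕 G) {T : Ω → ℝ≥0∞} (hT : Measurable T) :
    AEStronglyMeasurable (valueAt Z T) P := by
  have hm : ∀ n : ℕ, AEStronglyMeasurable
      ({ω | T ω = ⊤}ᶜ.indicator fun ω => Z (gridFloor n (T ω).toNNReal) ω) P := fun n =>
    ((measurable_gridFloor_comp hZ.1 n hT.ennreal_toNNReal).indicator
      (hT (measurableSet_singleton ⊤)).compl).aestronglyMeasurable
  refine aestronglyMeasurable_of_tendsto_ae atTop hm ?_
  filter_upwards [hZ.2.2, hZ.ae_tendsto_zero hG hA] with ω h1 h2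
  by_cases h : T ω = ⊤
  · have h0 : ω ∉ {ω | T ω = ⊤}ᶜ := fun hω => hω h
    simp only [Set.indicator_of_notMem h0]
    rw [valueAt, if_pos h, h2.limUnder_eq]
    exact tendsto_const_nhds
  · have h0 : ω ∈ {ω | T ω = ⊤}ᶜ := h
    simp only [Set.indicator_of_mem h0]
    rw [valueAt, if_neg h]
    exact h1.continuousAt.tendsto.comp (tendsto_gridFloor _)

theorem integrable_valueAt [IsProbabilityMeasure P] (hZ : IsContinuousAzema P 𝓕 G Z)
    (hG : Measurable G) (hA : AvoidsStoppingTimes P 𝓕 G) {T : Ω → ℝ≥0∞}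
    (hT : IsStoppingTime 𝓕 T) :
    Integrable (fun ω => valueAt Z T ω * (1 - valueAt Z T ω)) P := by
  have hTm : Measurable T := by
    refine measurable_of_Iic fun a => ?_
    induction a with
    | coe a => exact 𝓕.le a _ (hT a)
    | top => simp
  have hm := hZ.aestronglyMeasurable_valueAt hG hA hTm
  refine Integrable.of_bound (hm.mul (aestronglyMeasurable_const.sub hm)) 1 ?_
  filter_upwards [hZ.ae_valueAt_mem_Icc hG hA T] with ω hω
  rw [Real.norm_eq_abs, abs_le]
  constructor <;> nlinarith [hω.1, hω.2]

theorem measurableSet_abs_sub_half_lt (hZ : StronglyAdapted 𝓕 Z) (t : ℝ≥0) (ε : ℝ) :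
    MeasurableSet[𝓕 t] {ω | |Z t ω - 1 / 2| < ε} := by
  have h : Measurable[𝓕 t] (Z t) := (hZ t).measurable
  exact h (measurableSet_lt (measurable_id.sub_const _).abs measurable_const)

/-- There is a stopping time, the first time of the grid `ℕ / (n + 1)` at which the path is within `ε` of `1 / 2`,
where the value is near `1 / 2` as soon as the path is so at some time of the grid. -/
theorem exists_isStoppingTime_near_half (hZ : StronglyAdapted 𝓕 Z) (n : ℕ) (ε : ℝ) :
    ∃ T : Ω → ℝ≥0∞, IsStoppingTime 𝓕 T ∧ ∀ ω, (∃ k : ℕ, |Z (k / (n + 1)) ω - 1 / 2| < ε) →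
      |valueAt Z T ω - 1 / 2| < ε := by
  classical
  refine ⟨fun ω => if h : ∃ k : ℕ, |Z (k / (n + 1)) ω - 1 / 2| < ε then
    ((Nat.find h / (n + 1) : ℝ≥0) : ℝ≥0∞) else ⊤, fun t => ?_, fun ω h => ?_⟩
  · have hset : {ω | (if h : ∃ k : ℕ, |Z (k / (n + 1)) ω - 1 / 2| < ε then
        ((Nat.find h / (n + 1) : ℝ≥0) : ℝ≥0∞) else ⊤) ≤ (t : ℝ≥0∞)} =
        ⋃ k ∈ {k : ℕ | (k / (n + 1) : ℝ≥0) ≤ t}, {ω | |Z (k / (n + 1)) ω - 1 / 2| < ε} := by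
      ext ω
      simp only [Set.mem_ofPred_eq, Set.mem_iUnion, exists_prop]
      constructor
      · intro hle
        split_ifs at hle with h
        · exact ⟨Nat.find h, ENNReal.coe_le_coe.1 hle, Nat.find_spec h⟩
        · exact absurd hle (not_le.2 ENNReal.coe_lt_top)
      · rintro ⟨k, hk, hkε⟩
        rw [dif_pos ⟨k, hkε⟩, ENNReal.coe_le_coe]
        refine le_trans ?_ hk
        gcongr
        exact Nat.find_min' _ hkε
    change MeasurableSet[𝓕 t] {ω | (if h : ∃ k : ℕ, |Z (k / (n + 1)) ω - 1 / 2| < ε then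
        ((Nat.find h / (n + 1) : ℝ≥0) : ℝ≥0∞) else ⊤) ≤ (t : ℝ≥0∞)}
    rw [hset]
    exact MeasurableSet.biUnion (Set.to_countable _) fun k hk => 𝓕.mono hk _ <|
      measurableSet_abs_sub_half_lt hZ _ ε
  · simp only [valueAt, dif_pos h, ENNReal.coe_ne_top, if_false, ENNReal.toNNReal_coe]
    exact Nat.find_spec h

/-- Stopping on a grid avoids asking whether the hitting time of 1/2 is a stopping time. Since z(1 -
z) = 1/4 - (z - 1/2)², stopping within ε of 1/2 costs at most ε²; the other ε bounds the probability
that the grid misses this window. -/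
theorem exists_le_integral_valueAt [IsProbabilityMeasure P] (hZ : IsContinuousAzema P 𝓕 G Z)
    (hG : Measurable G) (hA : AvoidsStoppingTimes P 𝓕 G) {ε : ℝ} (hε : 0 < ε) :
    ∃ T : Ω → ℝ≥0∞, IsStoppingTime 𝓕 T ∧
      1 / 4 - ε ^ 2 - ε ≤ ∫ ω, valueAt Z T ω * (1 - valueAt Z T ω) ∂P := by
  set B : ℕ → Set Ω := fun n => {ω | ∃ k : ℕ, |Z (k / (n + 1)) ω - 1 / 2| < ε}ᶜ with hB
  have hBm : ∀ n, MeasurableSet (B n) := fun n => by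
    refine MeasurableSet.compl ?_
    simp only [Set.ofPred_exists]
    exact MeasurableSet.iUnion fun k => 𝓕.le _ _ (measurableSet_abs_sub_half_lt hZ.1 _ ε)
  -- Otherwise, with positive probability, infinitely many grids would miss the window. But grid
  -- points converging to a time where the path equals 1/2 eventually land in it.
  obtain ⟨n, hn⟩ : ∃ n, P (B n) < ENNReal.ofReal ε := by
    by_contra! hcon
    have h1 := le_measure_frequently (fun n => (hBm n).nullMeasurableSet)
      (Eventually.of_forall (f := atTop) hcon)
    have h2 : ∀ᵐ ω ∂P, ¬ ∃ᶠ n in atTop, ω ∈ B n := by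
      filter_upwards [hZ.ae_exists_eq_half hG hA, hZ.2.2] with ω ⟨s, hs⟩ hcont
      rw [not_frequently]
      have hlim := hcont.continuousAt.tendsto.comp (tendsto_gridFloor s)
      filter_upwards [hlim.eventually (Metric.ball_mem_nhds _ hε)] with n hn
      rw [Real.dist_eq, hs] at hn
      exact fun hω => hω ⟨⌊s * (n + 1)⌋₊, hn⟩
    rw [ae_iff] at h2
    simp only [not_not] at h2
    rw [h2, nonpos_iff_eq_zero, ENNReal.ofReal_eq_zero] at h1
    exact absurd hε (not_lt.2 h1)
  obtain ⟨T, hT, hval⟩ := exists_isStoppingTime_near_half hZ.1 n ε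
  refine ⟨T, hT, ?_⟩
  have hBreal : P.real (B n) ≤ ε := ENNReal.toReal_le_of_le_ofReal hε.le hn.le
  have hint : Integrable (fun ω => (1 / 4 - ε ^ 2) - (B n).indicator (fun _ => (1 : ℝ)) ω) P :=
    (integrable_const _).sub (integrable_indicator_one (hBm n))
  calc 1 / 4 - ε ^ 2 - ε ≤ 1 / 4 - ε ^ 2 - P.real (B n) := by linarith
    _ = ∫ ω, ((1 / 4 - ε ^ 2) - (B n).indicator (fun _ => (1 : ℝ)) ω) ∂P := by
        rw [integral_sub (integrable_const _) (integrable_indicator_one (hBm n)),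
          integral_indicator (hBm n)]
        simp
    _ ≤ _ := by
        refine integral_mono_ae hint (hZ.integrable_valueAt hG hA hT) ?_
        filter_upwards [hZ.ae_valueAt_mem_Icc hG hA T] with ω hω
        by_cases h : ω ∈ B n
        · rw [Set.indicator_of_mem h]
          nlinarith [hω.1, hω.2, sq_nonneg ε]
        · rw [Set.indicator_of_notMem h]
          have := abs_lt.1 (hval ω (not_not.1 h))
          nlinarith

end IsContinuousAzema

end ContinuousAzema

end AzemaNST

theorem mainTheorem1 {Ω : Type*} {m : MeasurableSpace Ω} (P : Measure Ω) [IsProbabilityMeasure P]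
    (𝓕 : Filtration ℝ≥0 m)
    (hC : AzemaNST.AllMartingalesContinuous P 𝓕)
    (Γ : Set (ℝ≥0 × Ω)) (hΓ : MeasurableSet[𝓕.predictable] Γ)
    (G : Ω → ℝ≥0∞) (hG : G = AzemaNST.endOf Γ) (hGm : AEMeasurable G P)
    (hA : AzemaNST.AvoidsStoppingTimes P 𝓕 G) :
    (∃ Z : ℝ≥0 → Ω → ℝ, AzemaNST.IsContinuousAzema P 𝓕 G Z) ∧
    ∀ Z : ℝ≥0 → Ω → ℝ, AzemaNST.IsContinuousAzema P 𝓕 G Z →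
      (Integrable (fun ω => ⨆ t : ℝ≥0, Z t ω * (1 - Z t ω)) P ∧
        ∫ ω, (⨆ t : ℝ≥0, Z t ω * (1 - Z t ω)) ∂P = 1 / 4) ∧
      (∀ T : Ω → ℝ≥0∞, IsStoppingTime 𝓕 T →
        Integrable (fun ω => AzemaNST.valueAt Z T ω * (1 - AzemaNST.valueAt Z T ω)) P) ∧
      IsLUB {x : ℝ | ∃ T : Ω → ℝ≥0∞, IsStoppingTime 𝓕 T ∧
        x = ∫ ω, AzemaNST.valueAt Z T ω * (1 - AzemaNST.valueAt Z T ω) ∂P} (1 / 4) := by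
  -- G is only almost everywhere measurable; (A) and the notion of continuous Azéma version are
  -- unchanged when G is replaced by an almost surely equal measurable function.
  have hGG := hGm.ae_eq_mk
  have hm := hGm.measurable_mk
  have hA' := hA.congr hGG
  refine ⟨?_, fun Z hZ => ?_⟩
  · obtain ⟨Z, hZ⟩ := AzemaNST.exists_isContinuousAzema hC hm hA'
    exact ⟨Z, hZ.congr hGG.symm⟩
  have hZ' := hZ.congr hGG
  have hsup := hZ'.ae_iSup_eq hm hA'
  refine ⟨⟨(integrable_congr hsup).2 (integrable_const _), ?_⟩,
    fun T hT => hZ'.integrable_valueAt hm hA' hT, ?_, fun b hb => ?_⟩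
  · rw [integral_congr_ae hsup]
    simp
  · rintro _ ⟨T, hT, rfl⟩
    calc _ ≤ ∫ _, (1 / 4 : ℝ) ∂P := integral_mono (hZ'.integrable_valueAt hm hA' hT)
          (integrable_const _) fun ω => by
            nlinarith [sq_nonneg (AzemaNST.valueAt Z T ω - 1 / 2)]
      _ = 1 / 4 := by simp
  · have hlim : Tendsto (fun ε : ℝ => 1 / 4 - ε ^ 2 - ε) (nhdsWithin 0 (Set.Ioi 0))
        (nhds (1 / 4)) := by
      have : Continuous fun ε : ℝ => 1 / 4 - ε ^ 2 - ε := by fun_prop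
      exact tendsto_nhdsWithin_of_tendsto_nhds (by simpa using this.tendsto 0)
    refine le_of_tendsto hlim (eventually_mem_nhdsWithin.mono fun ε hε => ?_)
    obtain ⟨T, hT, hle⟩ := hZ'.exists_le_integral_valueAt hm hA' hε
    exact hle.trans (hb ⟨T, hT, rfl⟩)
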